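/- For a group $G$ let $L^2(G)$ be the Hilbert space of square summable formal sums $\sum_{g\in G}\lambda_g\, g$ with $\lambda_g\in\mathbb{C}$. A matrix $A=(a_{k,j})\in M_{r,s}(\mathbb{Z}G)$ defines by right multiplication a bounded $G$-equivariant operator $$r_A^{(2)}\colon L^2(G)^r\to L^2(G)^s,\qquad (x_k)_{k}\mapsto\Bigl(\sum_{k=1}^r x_k a_{k,j}\Bigr)_{j}.$$ For a bounded $G$-equivariant operator $f\colon L^2(G)^r\to L^2(G)^s$ let $E_\mu=\mathbf 1_{(-\infty,\mu]}(f^*f)$ be the spectral projections of $f^*f$, and let $F_f(\lambda)=\dim_{\mathcal{N}(G)}(\operatorname{im}E_{\lambda^2})$ for $\lambda\ge 0$ and $F_f(\lambda)=0$ for $\lambda<0$, where the von Neumann dimension of the image of a $G$-equivariant orthogonal projection $P$ of $L^2(G)^r$ is $\sum_{i=1}^r\langle P e_i,e_i\rangle$, with $e_i$ the unit element of $G$ placed in the $i$-th summand. Let $dF_f$ be the Borel measure on $\mathbb{R}$ with $dF_f((a,b])=F_f(b)-F_f(a)$ for $a<b$. The Fuglede-Kadison determinant of $f$ is $\det_{\mathcal{N}(G)}(f)=\exp\bigl(\int_{(0,\infty)}\ln(\lambda)\,dF_f(\lambda)\bigr)$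 if this integral converges to a real number, and $0$ otherwise. The operator $f$ is a weak isomorphism if it is injective with dense image. Let $\Lambda(G)$ be the infimum of all values $\det_{\mathcal{N}(G)}(r_A^{(2)})>1$, where $A$ runs through $M_{r,s}(\mathbb{Z}G)$ for all $r,s\ge1$. Let $\Lambda_1(G)$ be the corresponding infimum over $(1,1)$-matrices only, $\Lambda^w(G)$ the one over square matrices $A$ (of any size) for which $r_A^{(2)}$ is a weak isomorphism, and $\Lambda_1^w(G)$ the one over $(1,1)$-matrices $A$ for which $r_A^{(2)}$ is a weak isomorphism. Let $n$ be an odd natural number. Then $$\Lambda^w(\mathbb{Z}/n)=\Lambda_1^w(\mathbb{Z}/n)=2^{1/n}.$$ The infimum is attained: for every generator $t$ of $\mathbb{Z}/n$ the element $t+1\in\mathbb{Z}[\mathbb{Z}/n]$ defines a weak isomorphism $r_{t+1}^{(2)}\colon L^2(\mathbb{Z}/n)\to L^2(\mathbb{Z}/n)$ with $\det_{\mathcal{N}(\mathbb{Z}/n)}(r_{t+1}^{(2)})=2^{1/n}$. Moreover, $$2^{1/(2n)}\le\Lambda(\mathbb{Z}/n)\le\Lambda_1(\mathbb{Z}/n)\le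 2^{1/n}.$$ -/

import Mathlib

noncomputable section

namespace LehmerGroup

open MeasureTheory Set

/-! ### The Hilbert spaces `L²(G)` and `L²(G)^r` -/

/-- The Hilbert space `L²(G)` of square summable families of complex numbers indexed by `G`; the
family `x` stands for the formal sum `∑ x g · g`. -/
abbrev L2 (G : Type*) : Type _ := lp (fun _ : G => ℂ) 2

/-- The Hilbert space direct sum `L²(G)^r`. -/
abbrev L2Pow (G : Type*) (r : ℕ) : Type _ := PiLp 2 (fun _ : Fin r => L2 G)

/-- Right multiplication by a group element `h` on `L²(G)`: the coefficient of `∑ x g · (g h)` at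
`g` is `x (g h⁻¹)`. -/
def rightTranslation {G : Type*} [Group G] (h : G) : L2 G →ₗᵢ[ℂ] L2 G where
  toFun x := ⟨fun g => x (g * h⁻¹), by
    have hx := (memℓp_gen_iff (p := 2) (by norm_num)).1 (lp.memℓp x)
    exact memℓp_gen (hx.comp_injective (mul_left_injective h⁻¹))⟩
  map_add' _ _ := rfl
  map_smul' _ _ := rfl
  norm_map' x := by
    have h2 : 0 < (2 : ENNReal).toReal := by norm_num
    simp only [lp.norm_eq_tsum_rpow h2]
    congr 1
    exact (Equiv.mulRight h⁻¹).tsum_eq (fun g => ‖x g‖ ^ (2 : ENNReal).toReal)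

/-- Right multiplication `L²(G) → L²(G)`, `x ↦ x · a`, by an element `a` of the integral group
ring. -/
def rightMul {G : Type*} [Group G] (a : MonoidAlgebra ℤ G) : L2 G →L[ℂ] L2 G :=
  ∑ h ∈ a.coeff.support, ((a.coeff h : ℤ) : ℂ) • (rightTranslation h).toContinuousLinearMap

/-- The bounded operator `L²(G)^r → L²(G)^s`, `x ↦ (∑ k, x k · A k j)_j`, given by right
multiplication with a matrix `A` over the integral group ring. -/
def rightMulMatrix {G : Type*} [Group G] {r s : ℕ}
    (A : Matrix (Fin r) (Fin s) (MonoidAlgebra ℤ G)) : L2Pow G r →L[ℂ] L2Pow G s :=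
  (PiLp.continuousLinearEquiv 2 ℂ (fun _ : Fin s => L2 G)).symm.toContinuousLinearMap ∘L
    ContinuousLinearMap.pi fun j =>
      ∑ k : Fin r, rightMul (A k j) ∘L PiLp.proj 2 (fun _ : Fin r => L2 G) k

/-! ### Von Neumann dimension, spectral density function, Fuglede-Kadison determinant -/

open Classical in
/-- The unit element `e ∈ G ⊆ L²(G)`, placed in the `i`-th summand of `L²(G)^r`. -/
def unitVec (G : Type*) [Group G] (r : ℕ) (i : Fin r) : L2Pow G r :=
  WithLp.toLp 2 (Pi.single i (lp.single 2 (1 : G) (1 : ℂ)))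

/-- The von Neumann dimension of the image of a `G`-equivariant orthogonal projection `P` of
`L²(G)^r`: the sum of the von Neumann traces `⟨P e, e⟩` of its diagonal entries. -/
def vnDim {G : Type*} [Group G] {r : ℕ} (P : L2Pow G r →L[ℂ] L2Pow G r) : ℝ :=
  ∑ i : Fin r, (inner ℂ (unitVec G r i) (P (unitVec G r i))).re

/-- The spectral projection `E_c = 1_{(-∞, c]}(T)` of a bounded self-adjoint operator `T`: the
orthogonal projection onto the kernel of the positive part `(T - c)₊`. -/
def spectralProjection {H : Type*} [NormedAddCommGroup H] [InnerProductSpace ℂ H]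
    [CompleteSpace H] (T : H →L[ℂ] H) (c : ℝ) : H →L[ℂ] H :=
  (cfc (fun x : ℝ => max (x - c) 0) T).ker.starProjection

/-- The spectral density function `F_f(c) = dim (im E_{c²})` for the spectral projections of
`f* f`, with `F_f(c) = 0` for `c < 0`. -/
def spectralDensity {G : Type*} [Group G] {r s : ℕ} (f : L2Pow G r →L[ℂ] L2Pow G s) (c : ℝ) : ℝ :=
  if 0 ≤ c then vnDim (spectralProjection (f.adjoint ∘L f) (c ^ 2)) else 0

theorem spectralProjection_mono {H : Type*} [NormedAddCommGroup H] [InnerProductSpace ℂ H]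
    [CompleteSpace H] (T : H →L[ℂ] H) : Monotone (spectralProjection T) := by
  intro a b hab
  refine Submodule.starProjection_le_starProjection_iff.2 ?_
  rcases hab.eq_or_lt with rfl | hlt
  · exact le_rfl
  have hfac : (fun x : ℝ => max (x - b) 0) =
      fun x => (max (x - b) 0 / max (x - a) (b - a)) * max (x - a) 0 := by
    funext x
    rcases le_total x b with h | h
    · simp [max_eq_right (sub_nonpos.2 h)]
    · have h1 : 0 < x - a := by linarith
      rw [max_eq_left (show b - a ≤ x - a by linarith), max_eq_left h1.le]
      field_simp
  by_cases hT : IsSelfAdjoint T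
  · have hc : Continuous fun x : ℝ => max (x - b) 0 / max (x - a) (b - a) := by
      refine Continuous.div (by fun_prop) (by fun_prop) fun x => ?_
      exact (lt_max_of_lt_right (sub_pos.2 hlt)).ne'
    rw [hfac, cfc_mul _ _ T hc.continuousOn (by fun_prop)]
    intro v hv
    have hv' : cfc (fun x : ℝ => max (x - a) 0) T v = 0 := hv
    change (cfc _ T) (cfc (fun x : ℝ => max (x - a) 0) T v) = 0
    rw [hv', map_zero]
  · rw [cfc_apply_of_not_predicate T hT, cfc_apply_of_not_predicate T hT]

theorem re_inner_spectralProjection_nonneg {H : Type*} [NormedAddCommGroup H]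
    [InnerProductSpace ℂ H] [CompleteSpace H] (T : H →L[ℂ] H) (c : ℝ) (v : H) :
    0 ≤ (inner ℂ v (spectralProjection T c v)).re := by
  have h := Submodule.re_inner_starProjection_nonneg (cfc (fun x : ℝ => max (x - c) 0) T).ker v
  rw [spectralProjection, ← Submodule.inner_starProjection_left_eq_right]
  exact h

theorem spectralDensity_mono {G : Type*} [Group G] {r s : ℕ} (f : L2Pow G r →L[ℂ] L2Pow G s) :
    Monotone (spectralDensity f) := by
  have key : ∀ P Q : L2Pow G r →L[ℂ] L2Pow G r, P ≤ Q → vnDim P ≤ vnDim Q := by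
    intro P Q h
    refine Finset.sum_le_sum fun i _ => ?_
    have h0 := ((ContinuousLinearMap.le_def _ _).1 h).re_inner_nonneg_right (unitVec G r i)
    simpa [inner_sub_right] using h0
  intro a b hab
  unfold spectralDensity
  split_ifs with ha hb hb
  · exact key _ _ (spectralProjection_mono _ (by gcongr))
  · exact absurd (ha.trans hab) hb
  · refine Finset.sum_nonneg fun i _ => ?_
    exact re_inner_spectralProjection_nonneg _ _ _
  · exact le_rfl

/-- The measure `dF` on `ℝ` with `dF (a, b] = F b - F a`, for the spectral density function `F` of
`f` (which is monotone and right-continuous, so that it is its own right limit). -/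
def spectralMeasure {G : Type*} [Group G] {r s : ℕ} (f : L2Pow G r →L[ℂ] L2Pow G s) : Measure ℝ :=
  (spectralDensity_mono f).stieltjesFunction.measure

open Classical in
/-- The Fuglede-Kadison determinant of `f`: it is `exp (∫_{0+}^∞ ln c dF(c))` if the integral
converges to a real number, and `0` otherwise. -/
def fkDet {G : Type*} [Group G] {r s : ℕ} (f : L2Pow G r →L[ℂ] L2Pow G s) : ℝ :=
  if IntegrableOn Real.log (Ioi 0) (spectralMeasure f) then
    Real.exp (∫ c in Ioi 0, Real.log c ∂(spectralMeasure f))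
  else 0

/-- A weak isomorphism: an injective operator with dense image. -/
def IsWeakIso {G : Type*} [Group G] {r s : ℕ} (f : L2Pow G r →L[ℂ] L2Pow G s) : Prop :=
  Function.Injective f ∧ DenseRange f

/-! ### Lehmer's constants of a group

The sets below contain the determinant `2` of the `(1,1)`-matrix `2` and are bounded below by `1`,
so the infima are honest ones. -/

/-- `Λ(G)`: all matrices over the integral group ring. -/
def lehmer (G : Type*) [Group G] : ℝ :=
  sInf {d : ℝ | 1 < d ∧ ∃ (r s : ℕ) (A : Matrix (Fin r) (Fin s) (MonoidAlgebra ℤ G)),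
    1 ≤ r ∧ 1 ≤ s ∧ fkDet (rightMulMatrix A) = d}

/-- `Λ₁(G)`: only `(1,1)`-matrices. -/
def lehmerOne (G : Type*) [Group G] : ℝ :=
  sInf {d : ℝ | 1 < d ∧ ∃ A : Matrix (Fin 1) (Fin 1) (MonoidAlgebra ℤ G),
    fkDet (rightMulMatrix A) = d}

/-- `Λ^w(G)`: only square matrices that induce a weak isomorphism. -/
def lehmerW (G : Type*) [Group G] : ℝ :=
  sInf {d : ℝ | 1 < d ∧ ∃ (r : ℕ) (A : Matrix (Fin r) (Fin r) (MonoidAlgebra ℤ G)),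
    1 ≤ r ∧ IsWeakIso (rightMulMatrix A) ∧ fkDet (rightMulMatrix A) = d}

/-- `Λ₁^w(G)`: only `(1,1)`-matrices that induce a weak isomorphism. -/
def lehmerOneW (G : Type*) [Group G] : ℝ :=
  sInf {d : ℝ | 1 < d ∧ ∃ A : Matrix (Fin 1) (Fin 1) (MonoidAlgebra ℤ G),
    IsWeakIso (rightMulMatrix A) ∧ fkDet (rightMulMatrix A) = d}

end LehmerGroup

end

noncomputable section

namespace LehmerGroup

open MeasureTheory Set Filter Topology

/-! ### Spectral projections in finite dimension -/

section Spectral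

variable {H : Type*} [NormedAddCommGroup H] [InnerProductSpace ℂ H] [FiniteDimensional ℂ H]
  [CompleteSpace H]

/-! For a finite group the group elements form an orthonormal basis of `L²(G)^r`, in which right
multiplication by `A` has an integer matrix `B = intMatrix A`. The von Neumann dimension is the
trace divided by `|G|`, so the spectral density function is a step function with a jump of `1/|G|`
at each singular value of `B`, counted with multiplicity. Hence the determinant is the `1/|G|`-th
power of the product of the nonzero singular values.

The squares of these multiply, up to sign, to the lowest nonzero coefficient `k` of the
characteristic polynomial of `Bᵀ B`. So the determinant is `|k|^(1/(2|G|))` with `k` a nonzero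
integer (`fkDet_rightMulMatrix`), and a value above `1` forces `|k| ≥ 2`. For a weak isomorphism
`|k| = (det B)²`, which improves the exponent to `1/|G|` (`fkDet_rightMulMatrix_of_det_ne_zero`).
The bound is attained by `t + 1`: multiplication by `t` has characteristic polynomial `X^n - 1`,
whose value at `-1` is `-2` for odd `n` (`abs_det_intMatrix_of_add_one`). -/

/-- In finite dimension the functional calculus acts on an eigenvector by the value of the function
at the eigenvalue. -/
theorem cfc_apply_of_apply_eq_smul {T : H →L[ℂ] H} (hT : IsSelfAdjoint T) (g : ℝ → ℝ) {μ : ℝ}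
    {x : H} (hx : T x = (μ : ℂ) • x) : cfc g T x = (g μ : ℂ) • x := by
  classical
  have : FiniteDimensional ℝ (H →L[ℂ] H) := FiniteDimensional.trans ℝ ℂ _
  have hfin : (spectrum ℝ T).Finite := by
    have hint : IsIntegral ℝ T := IsIntegral.of_finite ℝ T
    refine (minpoly ℝ T).rootSet_finite ℝ |>.subset fun k hk => ?_
    have h0 := spectrum.subset_polynomial_aeval T (minpoly ℝ T) ⟨k, hk, rfl⟩
    have : Nontrivial (H →L[ℂ] H) := by
      by_contra h
      rw [not_nontrivial_iff_subsingleton] at h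
      rw [spectrum.of_subsingleton] at hk
      exact hk
    rw [minpoly.aeval, spectrum.zero_eq] at h0
    rw [Polynomial.mem_rootSet]
    exact ⟨minpoly.ne_zero hint, by simpa using h0⟩
  -- On the finite spectrum `g` agrees with an interpolating polynomial. Adding `μ` as a node also
  -- covers `x = 0`, where `μ` need not be in the spectrum.
  set s : Finset ℝ := insert μ hfin.toFinset
  set p : Polynomial ℝ := Lagrange.interpolate s id g
  have hp : ∀ y ∈ s, p.eval y = g y := fun y hy =>
    Lagrange.eval_interpolate_at_node g (Function.injective_id.injOn) hy
  have h1 : cfc g T = Polynomial.aeval T p := by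
    rw [← cfc_polynomial p T hT]
    exact cfc_congr fun y hy => (hp y (by simp [s, hy])).symm
  have h2 : ∀ q : Polynomial ℝ, (Polynomial.aeval T q) x = ((q.eval μ : ℝ) : ℂ) • x := by
    intro q
    induction q using Polynomial.induction_on' with
    | add p q hp hq => simp [hp, hq, add_smul]
    | monomial k a =>
      have : ∀ k : ℕ, (T ^ k) x = ((μ : ℂ) ^ k) • x := by
        intro k
        induction k with
        | zero => simp
        | succ k ih => rw [pow_succ, mul_apply_eq_comp, hx, map_smul, ih, smul_smul,
            pow_succ']
      simp [Polynomial.aeval_monomial, this, Algebra.algebraMap_eq_smul_one, mul_smul]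
  rw [h1, h2, hp μ (by simp [s])]

/-- The spectral projection `1_{(-∞, c]}(T)` on an eigenvector of `T`. -/
theorem spectralProjection_apply_of_apply_eq_smul {T : H →L[ℂ] H} (hT : IsSelfAdjoint T) (c : ℝ)
    {μ : ℝ} {x : H} (hx : T x = (μ : ℂ) • x) :
    spectralProjection T c x = if μ ≤ c then x else 0 := by
  have hg := cfc_apply_of_apply_eq_smul hT (fun x => max (x - c) 0) hx
  rw [spectralProjection]
  split_ifs with h
  · rw [Submodule.starProjection_eq_self_iff]
    change cfc _ T x = 0
    rw [hg, max_eq_right (sub_nonpos.2 h)]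
    simp
  -- The self-adjoint operator `(T - c)₊` scales `x` by `μ - c ≠ 0`, so `x` is orthogonal to its
  -- kernel.
  · rw [Submodule.starProjection_apply_eq_zero_iff]
    intro y hy
    have hy' : cfc (fun x : ℝ => max (x - c) 0) T y = 0 := hy
    have hne : ((max (μ - c) 0 : ℝ) : ℂ) ≠ 0 := by
      rw [max_eq_left (by linarith)]
      exact_mod_cast (sub_pos.2 (not_le.1 h)).ne'
    have hsa : IsSelfAdjoint (cfc (fun x : ℝ => max (x - c) 0) T) := cfc_predicate _ _
    have h0 : inner ℂ y (cfc (fun x : ℝ => max (x - c) 0) T x) = 0 := by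
      rw [← ContinuousLinearMap.adjoint_inner_left, hsa.adjoint_eq, hy', inner_zero_left]
    rw [hg, inner_smul_right] at h0
    exact (mul_eq_zero.1 h0).resolve_left hne

/-- The trace of a spectral projection counts the eigenvalues up to the bound. -/
theorem trace_spectralProjection {T : H →L[ℂ] H} (hT : T.toLinearMap.IsSymmetric) {m : ℕ}
    (hm : Module.finrank ℂ H = m) (c : ℝ) :
    LinearMap.trace ℂ H (spectralProjection T c).toLinearMap =
      ∑ i, if hT.eigenvalues hm i ≤ c then 1 else 0 := by
  have hsa : IsSelfAdjoint T := ContinuousLinearMap.isSelfAdjoint_iff_isSymmetric.2 hT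
  rw [LinearMap.trace_eq_sum_inner _ (hT.eigenvectorBasis hm)]
  refine Finset.sum_congr rfl fun i _ => ?_
  have hi : T (hT.eigenvectorBasis hm i) = (hT.eigenvalues hm i : ℂ) • hT.eigenvectorBasis hm i :=
    hT.apply_eigenvectorBasis hm i
  rw [ContinuousLinearMap.coe_coe, spectralProjection_apply_of_apply_eq_smul hsa c hi]
  split_ifs <;> simp

/-- The spectral projections of `T` commute with whatever commutes with `T`. -/
theorem spectralProjection_apply_comm {T : H →L[ℂ] H} (hT : T.toLinearMap.IsSymmetric) (c : ℝ)
    (U : H →ₗ[ℂ] H) (hU : ∀ x, T (U x) = U (T x)) (x : H) :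
    spectralProjection T c (U x) = U (spectralProjection T c x) := by
  have hsa : IsSelfAdjoint T := ContinuousLinearMap.isSelfAdjoint_iff_isSymmetric.2 hT
  suffices h : (spectralProjection T c).toLinearMap ∘ₗ U = U ∘ₗ (spectralProjection T c).toLinearMap
    from LinearMap.congr_fun h x
  -- `U` preserves each eigenspace of `T`, so an eigenbasis suffices.
  refine (hT.eigenvectorBasis rfl).toBasis.ext fun i => ?_
  have hi : T (hT.eigenvectorBasis rfl i) = (hT.eigenvalues rfl i : ℂ) • hT.eigenvectorBasis rfl i :=
    hT.apply_eigenvectorBasis rfl i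
  have hi' : T (U (hT.eigenvectorBasis rfl i)) =
      (hT.eigenvalues rfl i : ℂ) • U (hT.eigenvectorBasis rfl i) := by
    rw [hU, hi, map_smul]
  simp only [OrthonormalBasis.coe_toBasis, LinearMap.comp_apply, ContinuousLinearMap.coe_coe]
  rw [spectralProjection_apply_of_apply_eq_smul hsa c hi,
    spectralProjection_apply_of_apply_eq_smul hsa c hi']
  split_ifs <;> simp

end Spectral

/-! ### Measures of step functions -/

/-- The measure of a step function with finitely many jumps of the same height. -/
theorem stieltjes_measure_of_step {ι : Type*} [Fintype ι] {F : ℝ → ℝ} (hF : Monotone F) {a : ℝ}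
    (ha : 0 ≤ a) (x : ι → ℝ) (h : ∀ c, F c = a * ∑ i, if x i ≤ c then 1 else 0) :
    hF.stieltjesFunction.measure = ENNReal.ofReal a • ∑ i, Measure.dirac (x i) := by
  -- The jumps use `≤`, so `F` is right-continuous and equals its right limit.
  have hright : ∀ c, hF.stieltjesFunction c = F c := by
    intro c
    rw [hF.stieltjesFunction_eq]
    refine rightLim_eq_of_tendsto ?_
    have hF' : F = fun c => a * ∑ i, if x i ≤ c then 1 else 0 := funext h
    rw [hF']
    refine Tendsto.const_mul _ (tendsto_finsetSum _ fun i _ => ?_)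
    refine tendsto_const_nhds.congr' ?_
    rcases le_or_gt (x i) c with hc | hc
    · filter_upwards [self_mem_nhdsWithin] with y hy
      simp [hc, hc.trans (le_of_lt hy)]
    · filter_upwards [mem_nhdsWithin_of_mem_nhds (Iio_mem_nhds hc)] with y hy
      simp [not_le.2 hc, not_le.2 (show y < x i from hy)]
  have : IsFiniteMeasure (ENNReal.ofReal a • ∑ i, Measure.dirac (x i)) :=
    Measure.smul_finite _ ENNReal.ofReal_ne_top
  refine Measure.ext_of_Ioc _ _ fun b c hbc => ?_
  rw [StieltjesFunction.measure_Ioc, hright, hright, h, h, ← mul_sub, ENNReal.ofReal_mul ha,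
    ← Finset.sum_sub_distrib, Measure.smul_apply, Measure.finsetSum_apply, smul_eq_mul,
    ENNReal.ofReal_sum_of_nonneg]
  · congr 1
    refine Finset.sum_congr rfl fun i _ => ?_
    rw [Measure.dirac_apply' _ measurableSet_Ioc]
    by_cases h1 : x i ≤ b
    · simp [h1, h1.trans hbc.le]
    · by_cases h2 : x i ≤ c <;> simp [h1, h2, not_le.1 h1]
  · intro i _
    by_cases h1 : x i ≤ b
    · simp [h1, h1.trans hbc.le]
    · simp only [h1, if_false, sub_zero]
      split_ifs <;> norm_num

/-- The logarithm is integrable for a measure with finitely many atoms; since `log 0 = 0`, an atom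
at `0` does not contribute. -/
theorem integral_log_step {ι : Type*} [Fintype ι] {a : ℝ} (ha : 0 ≤ a) {x : ι → ℝ}
    (hx : ∀ i, 0 ≤ x i) :
    IntegrableOn Real.log (Ioi 0) (ENNReal.ofReal a • ∑ i, Measure.dirac (x i)) ∧
    ∫ c in Ioi 0, Real.log c ∂(ENNReal.ofReal a • ∑ i, Measure.dirac (x i)) =
      a * ∑ i, Real.log (x i) := by
  have hint : Integrable Real.log (∑ i, Measure.dirac (x i)) := by
    rw [integrable_finsetSum_measure]
    intro i _
    exact integrable_dirac (by simp)
  have hint' := hint.smul_measure (c := ENNReal.ofReal a) ENNReal.ofReal_ne_top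
  refine ⟨hint'.integrableOn, ?_⟩
  rw [← integral_indicator measurableSet_Ioi]
  have hind : Integrable ((Ioi 0).indicator Real.log) (∑ i, Measure.dirac (x i)) :=
    hint.indicator measurableSet_Ioi
  rw [integral_smul_measure, integral_finsetSum_measure
    (integrable_finsetSum_measure.1 hind), ENNReal.toReal_ofReal ha, smul_eq_mul]
  congr 1
  refine Finset.sum_congr rfl fun i _ => ?_
  rw [integral_dirac]
  rcases (hx i).eq_or_lt with h | h
  · simp [← h]
  · simp [h]

/-! ### The orthonormal basis of group elements -/

section StandardBasis

variable {G : Type*}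

open Classical in
/-- The element `g ∈ G ⊆ L²(G)`, placed in the `i`-th summand of `L²(G)^r`. -/
def stdVec {r : ℕ} (p : Fin r × G) : L2Pow G r :=
  WithLp.toLp 2 (Pi.single p.1 (lp.single 2 p.2 (1 : ℂ)))

theorem inner_stdVec {r : ℕ} (p : Fin r × G) (x : L2Pow G r) :
    inner ℂ (stdVec p) x = x p.1 p.2 := by
  classical
  rw [PiLp.inner_apply, Finset.sum_eq_single p.1]
  · simp [stdVec, lp.inner_single_left]
  · intro j _ hj
    simp [stdVec, hj]
  · simp

open Classical in
theorem stdVec_apply {r : ℕ} (p q : Fin r × G) :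
    (stdVec p : L2Pow G r) q.1 q.2 = if p = q then 1 else 0 := by
  obtain ⟨i, g⟩ := p
  obtain ⟨j, h⟩ := q
  by_cases hij : i = j
  · subst hij
    by_cases hgh : g = h
    · subst hgh
      simp [stdVec]
    · simp [stdVec, hgh, lp.single_apply, Ne.symm hgh]
  · simp [stdVec, hij, Ne.symm hij]

/-- The orthonormal basis of `L²(G)^r` given by the group elements in the summands. -/
def stdBasis (G : Type*) [Fintype G] (r : ℕ) :
    OrthonormalBasis (Fin r × G) ℂ (L2Pow G r) :=
  OrthonormalBasis.mkOfOrthogonalEqBot (v := stdVec)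
    (by
      classical
      rw [orthonormal_iff_ite]
      intro p q
      rw [inner_stdVec, stdVec_apply]
      simp only [eq_comm])
    (by
      rw [Submodule.eq_bot_iff]
      intro x hx
      ext i g
      rw [← inner_stdVec (i, g) x]
      exact hx _ (Submodule.subset_span ⟨_, rfl⟩))

variable [Fintype G]

theorem stdBasis_apply {r : ℕ} (p : Fin r × G) : stdBasis G r p = stdVec p := by
  rw [stdBasis, OrthonormalBasis.coe_of_orthogonal_eq_bot_mk]

instance finiteDimensional_L2Pow (r : ℕ) : FiniteDimensional ℂ (L2Pow G r) :=
  (stdBasis G r).toBasis.finiteDimensional_of_finite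

end StandardBasis

/-! ### Integer matrices, equivariance and the trace -/

section Integral

variable {G : Type*} [Group G]

/-- The matrix of right multiplication by `A` in the standard bases. -/
def intMatrix {r s : ℕ} (A : Matrix (Fin r) (Fin s) (MonoidAlgebra ℤ G)) :
    Matrix (Fin s × G) (Fin r × G) ℤ :=
  Matrix.of fun p q => (A q.1 p.1).coeff (q.2⁻¹ * p.2)

theorem rightMul_apply (a : MonoidAlgebra ℤ G) (x : L2 G) (g : G) :
    rightMul a x g = ∑ h ∈ a.coeff.support, (a.coeff h : ℂ) * x (g * h⁻¹) := by
  simp only [rightMul, sum_apply, lp.coeFn_sum, Finset.sum_apply]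
  rfl

theorem rightMulMatrix_apply {r s : ℕ} (A : Matrix (Fin r) (Fin s) (MonoidAlgebra ℤ G))
    (x : L2Pow G r) (j : Fin s) : rightMulMatrix A x j = ∑ k, rightMul (A k j) (x k) := by
  simp [rightMulMatrix]

theorem rightMulMatrix_stdVec {r s : ℕ} (A : Matrix (Fin r) (Fin s) (MonoidAlgebra ℤ G))
    (p : Fin s × G) (q : Fin r × G) :
    rightMulMatrix A (stdVec q) p.1 p.2 = (intMatrix A p q : ℂ) := by
  classical
  rw [rightMulMatrix_apply, lp.coeFn_sum, Finset.sum_apply]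
  simp only [rightMul_apply]
  rw [Finset.sum_eq_single q.1, Finset.sum_eq_single (q.2⁻¹ * p.2)]
  · have := stdVec_apply q (q.1, p.2 * (q.2⁻¹ * p.2)⁻¹)
    simp only at this
    rw [this, if_pos]
    · simp [intMatrix]
    · ext <;> simp
  · intro h _ hh
    have := stdVec_apply q (q.1, p.2 * h⁻¹)
    simp only at this
    rw [this, if_neg, mul_zero]
    intro h'
    apply hh
    rw [h']
    simp
  · intro h
    simp [Finsupp.notMem_support_iff.1 h]
  · intro k _ hk
    refine Finset.sum_eq_zero fun h _ => ?_
    have := stdVec_apply q (k, p.2 * h⁻¹)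
    simp only at this
    rw [this, if_neg, mul_zero]
    intro h'
    apply hk
    rw [h']
  · simp

theorem unitVec_eq_stdVec {r : ℕ} (i : Fin r) : unitVec G r i = stdVec (i, 1) := rfl

variable [Fintype G]

theorem toMatrix_rightMulMatrix [DecidableEq G] {r s : ℕ}
    (A : Matrix (Fin r) (Fin s) (MonoidAlgebra ℤ G)) :
    LinearMap.toMatrix (stdBasis G r).toBasis (stdBasis G s).toBasis
      (rightMulMatrix A).toLinearMap = (intMatrix A).map (Int.castRingHom ℂ) := by
  ext p q
  rw [LinearMap.toMatrix_apply, OrthonormalBasis.coe_toBasis_repr_apply,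
    OrthonormalBasis.repr_apply_apply, OrthonormalBasis.coe_toBasis, stdBasis_apply, stdBasis_apply,
    inner_stdVec, ContinuousLinearMap.coe_coe, rightMulMatrix_stdVec]
  simp

/-- Integer entries are real, so the conjugate transpose is the transpose. -/
theorem toMatrix_adjoint_comp_rightMulMatrix [DecidableEq G] {r s : ℕ}
    (A : Matrix (Fin r) (Fin s) (MonoidAlgebra ℤ G)) :
    LinearMap.toMatrix (stdBasis G r).toBasis (stdBasis G r).toBasis
      ((rightMulMatrix A).adjoint ∘L rightMulMatrix A).toLinearMap =
      ((intMatrix A).transpose * intMatrix A).map (Int.castRingHom ℂ) := by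
  rw [ContinuousLinearMap.toLinearMap_comp, LinearMap.toMatrix_comp _ (stdBasis G s).toBasis,
    ← ContinuousLinearMap.adjoint_toLinearMap, LinearMap.toMatrix_adjoint, toMatrix_rightMulMatrix,
    Matrix.map_mul]
  congr 1
  ext p q
  simp

/-- Left translation by `g` on `L²(G)^r`. -/
def leftTranslation (r : ℕ) (g : G) : L2Pow G r ≃ₗᵢ[ℂ] L2Pow G r :=
  (stdBasis G r).equiv (stdBasis G r) (Equiv.prodCongr (Equiv.refl _) (Equiv.mulLeft g))

theorem leftTranslation_stdVec {r : ℕ} (g : G) (p : Fin r × G) :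
    leftTranslation r g (stdVec p) = stdVec (p.1, g * p.2) := by
  rw [← stdBasis_apply, leftTranslation, OrthonormalBasis.equiv_apply_basis, stdBasis_apply]
  rfl

theorem leftTranslation_symm_stdVec {r : ℕ} (g : G) (p : Fin r × G) :
    (leftTranslation r g).symm (stdVec p) = stdVec (p.1, g⁻¹ * p.2) := by
  rw [LinearIsometryEquiv.symm_apply_eq, leftTranslation_stdVec]
  simp

/-- The entries of `intMatrix A` depend on the group coordinates only through `q.2⁻¹ * p.2`, which
left translation does not change. -/
theorem rightMulMatrix_leftTranslation {r s : ℕ} (A : Matrix (Fin r) (Fin s) (MonoidAlgebra ℤ G))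
    (g : G) (x : L2Pow G r) :
    rightMulMatrix A (leftTranslation r g x) = leftTranslation s g (rightMulMatrix A x) := by
  suffices h : (rightMulMatrix A).toLinearMap ∘ₗ (leftTranslation r g).toLinearMap =
      (leftTranslation s g).toLinearMap ∘ₗ (rightMulMatrix A).toLinearMap
    from LinearMap.congr_fun h x
  refine (stdBasis G r).toBasis.ext fun q => ?_
  rw [OrthonormalBasis.coe_toBasis, stdBasis_apply]
  refine (stdBasis G s).repr.injective (PiLp.ext fun p => ?_)
  rw [OrthonormalBasis.repr_apply_apply, OrthonormalBasis.repr_apply_apply, stdBasis_apply]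
  change inner ℂ (stdVec p) (rightMulMatrix A (leftTranslation r g (stdVec q))) =
    inner ℂ (stdVec p) (leftTranslation s g (rightMulMatrix A (stdVec q)))
  rw [← LinearIsometryEquiv.inner_map_map (leftTranslation s g).symm (stdVec p)
    (leftTranslation s g _), LinearIsometryEquiv.symm_apply_apply, leftTranslation_symm_stdVec,
    leftTranslation_stdVec, inner_stdVec, inner_stdVec, rightMulMatrix_stdVec,
    rightMulMatrix_stdVec]
  simp [intMatrix, mul_assoc]

theorem adjoint_rightMulMatrix_leftTranslation {r s : ℕ}
    (A : Matrix (Fin r) (Fin s) (MonoidAlgebra ℤ G)) (g : G) (x : L2Pow G s) :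
    (rightMulMatrix A).adjoint (leftTranslation s g x) =
      leftTranslation r g ((rightMulMatrix A).adjoint x) := by
  refine ext_inner_right ℂ fun y => ?_
  obtain ⟨y, rfl⟩ := (leftTranslation r g).surjective y
  rw [ContinuousLinearMap.adjoint_inner_left, LinearIsometryEquiv.inner_map_map,
    ContinuousLinearMap.adjoint_inner_left, rightMulMatrix_leftTranslation,
    LinearIsometryEquiv.inner_map_map]

/-- The von Neumann dimension over a finite group is the normalized trace. -/
theorem card_mul_vnDim {r : ℕ} (P : L2Pow G r →L[ℂ] L2Pow G r)
    (hP : ∀ g x, P (leftTranslation r g x) = leftTranslation r g (P x)) :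
    Fintype.card G * vnDim P = (LinearMap.trace ℂ _ P.toLinearMap).re := by
  rw [LinearMap.trace_eq_sum_inner _ (stdBasis G r), Complex.re_sum, Fintype.sum_prod_type, vnDim,
    Finset.mul_sum]
  refine Finset.sum_congr rfl fun i _ => ?_
  have : ∀ g : G, inner ℂ (stdBasis G r (i, g)) (P (stdBasis G r (i, g))) =
      inner ℂ (unitVec G r i) (P (unitVec G r i)) := by
    intro g
    have h : stdBasis G r (i, g) = leftTranslation r g (unitVec G r i) := by
      rw [unitVec_eq_stdVec, leftTranslation_stdVec, stdBasis_apply]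
      simp
    rw [h, hP, LinearIsometryEquiv.inner_map_map]
  simp [this]

end Integral

/-! ### The determinant through singular values -/

theorem isSymmetric_adjoint_comp {G : Type*} {r s : ℕ} (f : L2Pow G r →L[ℂ] L2Pow G s) :
    (f.adjoint ∘L f).toLinearMap.IsSymmetric := by
  intro x y
  change inner ℂ (f.adjoint (f x)) y = inner ℂ x (f.adjoint (f y))
  rw [ContinuousLinearMap.adjoint_inner_left, ContinuousLinearMap.adjoint_inner_right]

section EigenvalueFormula

variable {G : Type*} [Fintype G]

theorem eigenvalues_adjoint_comp_nonneg {r s m : ℕ} (f : L2Pow G r →L[ℂ] L2Pow G s)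
    (hm : Module.finrank ℂ (L2Pow G r) = m) (i : Fin m) :
    0 ≤ (isSymmetric_adjoint_comp f).eigenvalues hm i := by
  refine eigenvalue_nonneg_of_nonneg ((isSymmetric_adjoint_comp f).hasEigenvalue_eigenvalues hm i)
    fun x => ?_
  change 0 ≤ RCLike.re (inner ℂ x (f.adjoint (f x)))
  rw [ContinuousLinearMap.adjoint_inner_right]
  exact inner_self_nonneg

variable [Group G]

theorem spectralDensity_rightMulMatrix {r s m : ℕ}
    (A : Matrix (Fin r) (Fin s) (MonoidAlgebra ℤ G))
    (hm : Module.finrank ℂ (L2Pow G r) = m) (c : ℝ) :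
    spectralDensity (rightMulMatrix A) c = (Fintype.card G : ℝ)⁻¹ * ∑ i,
      if √((isSymmetric_adjoint_comp (rightMulMatrix A)).eigenvalues hm i) ≤ c then 1 else 0 := by
  have hcard : (Fintype.card G : ℝ) ≠ 0 := by exact_mod_cast Fintype.card_ne_zero
  rw [eq_inv_mul_iff_mul_eq₀ hcard, spectralDensity]
  split_ifs with hc
  · rw [card_mul_vnDim, trace_spectralProjection (isSymmetric_adjoint_comp _) hm, Complex.re_sum]
    · refine Finset.sum_congr rfl fun i _ => ?_
      simp only [Real.sqrt_le_left hc]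
      split_ifs <;> simp
    · intro g x
      refine spectralProjection_apply_comm (isSymmetric_adjoint_comp _) _
        (leftTranslation r g).toLinearMap (fun y => ?_) x
      change (rightMulMatrix A).adjoint (rightMulMatrix A (leftTranslation r g y)) =
        leftTranslation r g ((rightMulMatrix A).adjoint (rightMulMatrix A y))
      rw [rightMulMatrix_leftTranslation, adjoint_rightMulMatrix_leftTranslation]
  · rw [mul_zero]
    refine (Finset.sum_eq_zero fun i _ => if_neg fun h => hc ?_).symm
    exact (Real.sqrt_nonneg _).trans h

theorem fkDet_rightMulMatrix_eq_exp {r s m : ℕ} (A : Matrix (Fin r) (Fin s) (MonoidAlgebra ℤ G))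
    (hm : Module.finrank ℂ (L2Pow G r) = m) :
    fkDet (rightMulMatrix A) = Real.exp ((Fintype.card G : ℝ)⁻¹ *
      ∑ i, Real.log √((isSymmetric_adjoint_comp (rightMulMatrix A)).eigenvalues hm i)) := by
  have hmeas := stieltjes_measure_of_step (spectralDensity_mono (rightMulMatrix A))
    (by positivity) _ (spectralDensity_rightMulMatrix A hm)
  obtain ⟨h1, h2⟩ := integral_log_step (a := (Fintype.card G : ℝ)⁻¹) (by positivity)
    fun i => Real.sqrt_nonneg ((isSymmetric_adjoint_comp (rightMulMatrix A)).eigenvalues hm i)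
  rw [fkDet, spectralMeasure, hmeas, if_pos h1, h2]

end EigenvalueFormula

/-! ### Trailing coefficients and products of nonzero roots -/

section TrailingCoeff

open Polynomial

theorem trailingCoeff_map_of_injective {R S : Type*} [Semiring R] [Semiring S] {φ : R →+* S}
    (hφ : Function.Injective φ) (p : R[X]) : (p.map φ).trailingCoeff = φ p.trailingCoeff := by
  rw [trailingCoeff, trailingCoeff, coeff_map, natTrailingDegree, natTrailingDegree, trailingDegree,
    trailingDegree, support_map_of_injective p hφ]

open Classical in
-- A root `0` contributes the factor `1`, in accordance with `log 0 = 0`.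
theorem trailingCoeff_X_sub_C {R : Type*} [Ring R] [Nontrivial R] (a : R) :
    (X - C a).trailingCoeff = if a = 0 then 1 else -a := by
  split_ifs with h
  · simp [h, trailingCoeff]
  · rw [trailingCoeff_eq_coeff_zero (by simpa using h)]
    simp

theorem trailingCoeff_prod {R ι : Type*} [CommRing R] [IsDomain R] (s : Finset ι) (p : ι → R[X]) :
    (∏ i ∈ s, p i).trailingCoeff = ∏ i ∈ s, (p i).trailingCoeff := by
  classical
  induction s using Finset.induction_on with
  | empty => simp [trailingCoeff]
  | insert i s hi ih => rw [Finset.prod_insert hi, trailingCoeff_mul, ih, Finset.prod_insert hi]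

/-- With the convention `log 0 = 0`, the sum of the logarithms of the roots is the logarithm of the
trailing coefficient. -/
theorem log_norm_trailingCoeff_prod {ι : Type*} [Fintype ι] (μ : ι → ℝ) :
    Real.log ‖(∏ i, (X - C (μ i : ℂ))).trailingCoeff‖ = ∑ i, Real.log (μ i) := by
  rw [trailingCoeff_prod, norm_prod, Real.log_prod]
  · refine Finset.sum_congr rfl fun i _ => ?_
    rw [trailingCoeff_X_sub_C]
    by_cases h : μ i = 0 <;> simp [h]
  · intro i _
    rw [norm_ne_zero_iff, trailingCoeff_nonzero_iff_nonzero]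
    exact X_sub_C_ne_zero _

end TrailingCoeff

/-! ### The determinant through integers -/

section DeterminantFormula

variable {G : Type*} [Group G] [Fintype G] [DecidableEq G]

/-- The Fuglede-Kadison determinant over a finite group, through the lowest nonzero coefficient of
an integral characteristic polynomial. -/
theorem fkDet_rightMulMatrix {r s : ℕ} (A : Matrix (Fin r) (Fin s) (MonoidAlgebra ℤ G)) :
    fkDet (rightMulMatrix A) =
      (|((intMatrix A).transpose * intMatrix A).charpoly.trailingCoeff| : ℝ) ^
        (1 / (2 * (Fintype.card G : ℝ))) := by
  set p := ((intMatrix A).transpose * intMatrix A).charpoly with hp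
  have hp0 : p.trailingCoeff ≠ 0 :=
    Polynomial.trailingCoeff_nonzero_iff_nonzero.2 (Matrix.charpoly_monic _).ne_zero
  have hchar : p.map (Int.castRingHom ℂ) =
      ∏ i, (Polynomial.X - Polynomial.C
        ((isSymmetric_adjoint_comp (rightMulMatrix A)).eigenvalues rfl i : ℂ)) := by
    rw [hp, ← Matrix.charpoly_map, ← toMatrix_adjoint_comp_rightMulMatrix,
      LinearMap.charpoly_toMatrix]
    exact (isSymmetric_adjoint_comp (rightMulMatrix A)).charpoly_eq rfl
  have hlog : Real.log |(p.trailingCoeff : ℝ)| =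
      ∑ i, Real.log ((isSymmetric_adjoint_comp (rightMulMatrix A)).eigenvalues rfl i) := by
    rw [← log_norm_trailingCoeff_prod, ← hchar,
      trailingCoeff_map_of_injective (RingHom.injective_int _)]
    simp
  rw [fkDet_rightMulMatrix_eq_exp A rfl, Real.rpow_def_of_pos (by positivity), hlog]
  congr 1
  -- Passing from eigenvalues of `f* f` to singular values gives the `2` in the exponent.
  simp only [Real.log_sqrt (eigenvalues_adjoint_comp_nonneg _ _ _), ← Finset.sum_div]
  field_simp

theorem fkDet_rightMulMatrix_of_det_ne_zero {r : ℕ}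
    (A : Matrix (Fin r) (Fin r) (MonoidAlgebra ℤ G)) (h : (intMatrix A).det ≠ 0) :
    fkDet (rightMulMatrix A) = (|(intMatrix A).det| : ℝ) ^ (1 / (Fintype.card G : ℝ)) := by
  have hdet : |((intMatrix A).transpose * intMatrix A).charpoly.coeff 0| =
      |(intMatrix A).det| ^ 2 := by
    have := Matrix.det_eq_sign_charpoly_coeff ((intMatrix A).transpose * intMatrix A)
    rw [Matrix.det_mul, Matrix.det_transpose] at this
    rw [← abs_pow, pow_two, this, abs_mul]
    simp
  have h0 : ((intMatrix A).transpose * intMatrix A).charpoly.coeff 0 ≠ 0 := by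
    rw [← abs_pos, hdet]
    positivity
  rw [fkDet_rightMulMatrix, Polynomial.trailingCoeff_eq_coeff_zero h0]
  have hdet' := congrArg (Int.cast : ℤ → ℝ) hdet
  rw [Int.cast_abs, Int.cast_pow, Int.cast_abs] at hdet'
  rw [hdet', ← Real.rpow_natCast, ← Real.rpow_mul (abs_nonneg _)]
  congr 1
  have : (Fintype.card G : ℝ) ≠ 0 := by exact_mod_cast Fintype.card_ne_zero
  push_cast
  field_simp

theorem isWeakIso_rightMulMatrix_iff {r : ℕ} (A : Matrix (Fin r) (Fin r) (MonoidAlgebra ℤ G)) :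
    IsWeakIso (rightMulMatrix A) ↔ (intMatrix A).det ≠ 0 := by
  have hdet : LinearMap.det (rightMulMatrix A).toLinearMap = ((intMatrix A).det : ℂ) := by
    rw [← LinearMap.det_toMatrix (stdBasis G r).toBasis, toMatrix_rightMulMatrix,
      ← RingHom.mapMatrix_apply, ← RingHom.map_det]
    simp
  have hiff : Function.Injective (rightMulMatrix A).toLinearMap ↔ (intMatrix A).det ≠ 0 := by
    rw [← LinearMap.ker_eq_bot, ← LinearMap.isUnit_iff_ker_eq_bot, LinearMap.isUnit_iff_isUnit_det,
      hdet, isUnit_iff_ne_zero, Int.cast_ne_zero]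
  refine ⟨fun h => hiff.1 h.1, fun h => ⟨hiff.2 h, ?_⟩⟩
  exact (LinearMap.injective_iff_surjective.1 (hiff.2 h)).denseRange

end DeterminantFormula

/-- No integer lies strictly between `1` and `2`. -/
theorem two_rpow_le_of_one_lt {k : ℤ} {y : ℝ} (hy : 0 ≤ y) (h : 1 < (|k| : ℝ) ^ y) :
    (2 : ℝ) ^ y ≤ (|k| : ℝ) ^ y := by
  refine Real.rpow_le_rpow (by norm_num) ?_ hy
  have h1 : ¬ (|k| : ℝ) ≤ 1 := fun h1 => (Real.rpow_le_one (abs_nonneg _) h1 hy).not_gt h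
  have h2 : 1 < |k| := by exact_mod_cast not_le.1 h1
  exact_mod_cast h2

/-! ### Multiplication by a generator of a cyclic group -/

section Cyclic

open Polynomial

/-- A matrix of size `n` with `M ^ n = 1` and a cyclic vector has characteristic polynomial
`X ^ n - 1`. -/
theorem charpoly_eq_X_pow_sub_one {K ι : Type*} [Field K] [Fintype ι] [DecidableEq ι]
    {M : Matrix ι ι K} {x : ι → K} (hι : Fintype.card ι ≠ 0) (hM : M ^ Fintype.card ι = 1)
    (hx : LinearIndependent K fun k : Fin (Fintype.card ι) => (M ^ (k : ℕ)).mulVec x) :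
    M.charpoly = X ^ Fintype.card ι - 1 := by
  have hdeg : ((X : K[X]) ^ Fintype.card ι - 1).degree = Fintype.card ι := by
    simpa using degree_X_pow_sub_C (Nat.pos_of_ne_zero hι) (1 : K)
  have hmonic : ((X : K[X]) ^ Fintype.card ι - 1).Monic := by
    simpa using monic_X_pow_sub_C (1 : K) hι
  -- An annihilating polynomial of smaller degree, applied to `x`, would be a linear relation
  -- between the vectors in `hx`.
  have hmin : X ^ Fintype.card ι - 1 = minpoly K M := by
    refine minpoly.unique K M hmonic (by simp [hM]) fun q hq hq0 => ?_
    rw [hdeg]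
    by_contra hlt
    have hlt' : q.natDegree < Fintype.card ι :=
      (natDegree_lt_iff_degree_lt hq.ne_zero).2 (not_le.1 hlt)
    have hsum : ∑ k : Fin (Fintype.card ι), q.coeff k • (M ^ (k : ℕ)).mulVec x = 0 := by
      have h := congrArg (fun N : Matrix ι ι K => N.mulVec x) hq0
      rw [aeval_eq_sum_range' hlt', ← Fin.sum_univ_eq_sum_range (fun k => q.coeff k • M ^ k)] at h
      simpa [Matrix.sum_mulVec, Matrix.smul_mulVec] using h
    have h0 := Fintype.linearIndependent_iff.1 hx _ hsum
    exact hq.ne_zero (Polynomial.ext fun k => by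
      by_cases hk : k < Fintype.card ι
      · simpa using h0 ⟨k, hk⟩
      · simpa using coeff_eq_zero_of_natDegree_lt (hlt'.trans_le (not_lt.1 hk)))
  refine (eq_of_monic_of_dvd_of_natDegree_le hmonic (Matrix.charpoly_monic M) ?_ ?_)
  · rw [hmin]
    exact Matrix.minpoly_dvd_charpoly M
  · rw [Matrix.charpoly_natDegree_eq_dim, natDegree_eq_of_degree_eq_some hdeg]

variable {G : Type*} [Group G] [Fintype G] [DecidableEq G]

/-- Multiplication by `t` permutes the basis, so the orbit of one basis vector provides a cyclic
vector. -/
theorem intMatrix_of_pow_mulVec_single (t : G) (k : ℕ) (g : G) :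
    (((intMatrix (Matrix.of fun _ _ : Fin 1 => MonoidAlgebra.of ℤ G t)).map
      (Int.castRingHom ℚ)) ^ k).mulVec (Pi.single (0, g) 1) = Pi.single (0, g * t ^ k) 1 := by
  induction k generalizing g with
  | zero => rw [pow_zero, Matrix.one_mulVec, pow_zero, mul_one]
  | succ k ih =>
    have h1 : ((intMatrix (Matrix.of fun _ _ : Fin 1 => MonoidAlgebra.of ℤ G t)).map
        (Int.castRingHom ℚ)).mulVec (Pi.single (0, g) 1) = Pi.single (0, g * t) 1 := by
      ext ⟨i, h⟩
      obtain rfl := Subsingleton.elim i 0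
      simp only [Matrix.mulVec_single_one, Matrix.col_apply, Matrix.map_apply, intMatrix,
        Matrix.of_apply, MonoidAlgebra.of_apply, Pi.single_apply, Prod.mk.injEq, true_and]
      rw [MonoidAlgebra.coeff_single, Finsupp.single_apply]
      by_cases ht : h = g * t
      · simp [ht]
      · rw [if_neg ht, if_neg]
        · simp
        · rintro rfl
          simp at ht
    rw [pow_succ, ← Matrix.mulVec_mulVec, h1, ih, mul_assoc, pow_succ']

theorem abs_det_intMatrix_of_add_one (hodd : Odd (Fintype.card G)) {t : G}
    (ht : Subgroup.zpowers t = ⊤) :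
    |(intMatrix (Matrix.of fun _ _ : Fin 1 => MonoidAlgebra.of ℤ G t + 1)).det| = 2 := by
  set S := intMatrix (Matrix.of fun _ _ : Fin 1 => MonoidAlgebra.of ℤ G t) with hS
  have hcard : Fintype.card (Fin 1 × G) = Fintype.card G := by simp
  have horder : orderOf t = Fintype.card G := by
    rw [← Nat.card_eq_fintype_card]
    exact orderOf_eq_card_of_zpowers_eq_top ht
  have hadd : intMatrix (Matrix.of fun _ _ : Fin 1 => MonoidAlgebra.of ℤ G t + 1) = S + 1 := by
    ext ⟨i, h⟩ ⟨j, g⟩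
    obtain rfl := Subsingleton.elim i 0
    obtain rfl := Subsingleton.elim j 0
    simp only [hS, intMatrix, Matrix.of_apply, Matrix.add_apply, MonoidAlgebra.coeff_add,
      Finsupp.add_apply, Matrix.one_apply, MonoidAlgebra.one_def, MonoidAlgebra.coeff_single,
      Finsupp.single_apply, Prod.mk.injEq, true_and]
    congr 2
    rw [eq_comm (a := 1), inv_mul_eq_one, eq_comm (a := g)]
  have hchar : (S.map (Int.castRingHom ℚ)).charpoly = X ^ Fintype.card G - 1 := by
    rw [← hcard]
    refine charpoly_eq_X_pow_sub_one (x := Pi.single (0, 1) 1) (by simp) ?_ ?_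
    · refine Matrix.ext_of_mulVec_single fun ⟨i, g⟩ => ?_
      obtain rfl := Subsingleton.elim i 0
      rw [hS, intMatrix_of_pow_mulVec_single, hcard, ← horder, pow_orderOf_eq_one, mul_one,
        Matrix.one_mulVec]
    · simp only [hS, intMatrix_of_pow_mulVec_single]
      have hinj : Function.Injective fun k : Fin (Fintype.card (Fin 1 × G)) =>
          ((0, 1 * t ^ (k : ℕ)) : Fin 1 × G) := by
        intro a b hab
        have hab' : t ^ (a : ℕ) = t ^ (b : ℕ) := by simpa using hab
        exact Fin.ext (pow_injOn_Iio_orderOf (by rw [horder, ← hcard]; exact a.2)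
          (by rw [horder, ← hcard]; exact b.2) hab')
      have := (Pi.basisFun ℚ (Fin 1 × G)).linearIndependent.comp _ hinj
      simpa [Function.comp_def] using this
  have hcharZ : S.charpoly = X ^ Fintype.card G - 1 := by
    -- The minimal polynomial argument needs a field; the identity descends from `ℚ` to `ℤ`.
    apply Polynomial.map_injective (Int.castRingHom ℚ) (RingHom.injective_int _)
    rw [← Matrix.charpoly_map, hchar]
    simp
  -- At `-1` the characteristic polynomial is `det (-(S + 1))`, and also `(-1)^n - 1 = -2` by
  -- oddness.
  have heval := Matrix.eval_charpoly S (-1)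
  have hneg : Matrix.scalar (Fin 1 × G) (-1 : ℤ) - S = -(S + 1) := by
    rw [map_neg, map_one]
    abel
  rw [hcharZ, hneg, Matrix.det_neg] at heval
  rw [hadd]
  have habs := congrArg abs heval
  rw [abs_mul] at habs
  simpa [hodd.neg_one_pow] using habs.symm

end Cyclic

end LehmerGroup

end

/-! ### The Lehmer constants of odd cyclic groups -/

open LehmerGroup in
theorem mainTheorem11 (n : ℕ) (hn : Odd n) :
    LehmerGroup.lehmerW (Multiplicative (ZMod n)) = (2 : ℝ) ^ (1 / (n : ℝ)) ∧
    LehmerGroup.lehmerOneW (Multiplicative (ZMod n)) = (2 : ℝ) ^ (1 / (n : ℝ)) ∧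
    (∀ t : Multiplicative (ZMod n), Subgroup.zpowers t = ⊤ →
      LehmerGroup.IsWeakIso (LehmerGroup.rightMulMatrix
        (Matrix.of fun _ _ : Fin 1 => MonoidAlgebra.of ℤ _ t + 1)) ∧
      LehmerGroup.fkDet (LehmerGroup.rightMulMatrix
        (Matrix.of fun _ _ : Fin 1 => MonoidAlgebra.of ℤ _ t + 1)) = (2 : ℝ) ^ (1 / (n : ℝ))) ∧
    (2 : ℝ) ^ (1 / (2 * (n : ℝ))) ≤ LehmerGroup.lehmer (Multiplicative (ZMod n)) ∧
    LehmerGroup.lehmer (Multiplicative (ZMod n)) ≤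
      LehmerGroup.lehmerOne (Multiplicative (ZMod n)) ∧
    LehmerGroup.lehmerOne (Multiplicative (ZMod n)) ≤ (2 : ℝ) ^ (1 / (n : ℝ)) := by
  have : NeZero n := ⟨hn.pos.ne'⟩
  have hpos : (0 : ℝ) < n := by exact_mod_cast hn.pos
  have hcard : Fintype.card (Multiplicative (ZMod n)) = n := by simp
  have hone : (1 : ℝ) < 2 ^ (1 / (n : ℝ)) := Real.one_lt_rpow (by norm_num) (by positivity)
  have hgen : ∀ t : Multiplicative (ZMod n), Subgroup.zpowers t = ⊤ →
      IsWeakIso (rightMulMatrix (Matrix.of fun _ _ : Fin 1 => MonoidAlgebra.of ℤ _ t + 1)) ∧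
      fkDet (rightMulMatrix (Matrix.of fun _ _ : Fin 1 => MonoidAlgebra.of ℤ _ t + 1)) =
        (2 : ℝ) ^ (1 / (n : ℝ)) := by
    intro t ht
    have habs := abs_det_intMatrix_of_add_one (by rwa [hcard]) ht
    have hne : (intMatrix (Matrix.of fun _ _ : Fin 1 => MonoidAlgebra.of ℤ _ t + 1)).det ≠ 0 := by
      rw [← abs_pos, habs]
      norm_num
    refine ⟨(isWeakIso_rightMulMatrix_iff _).2 hne, ?_⟩
    rw [fkDet_rightMulMatrix_of_det_ne_zero _ hne, hcard, ← Int.cast_abs, habs]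
    norm_num
  have hlow : ∀ (r : ℕ) (A : Matrix (Fin r) (Fin r) (MonoidAlgebra ℤ (Multiplicative (ZMod n)))),
      IsWeakIso (rightMulMatrix A) → 1 < fkDet (rightMulMatrix A) →
      (2 : ℝ) ^ (1 / (n : ℝ)) ≤ fkDet (rightMulMatrix A) := by
    intro r A hA h
    rw [fkDet_rightMulMatrix_of_det_ne_zero _ ((isWeakIso_rightMulMatrix_iff A).1 hA), hcard] at h ⊢
    exact two_rpow_le_of_one_lt (by positivity) h
  obtain ⟨t, ht⟩ : ∃ t : Multiplicative (ZMod n), Subgroup.zpowers t = ⊤ := by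
    obtain ⟨t, ht⟩ := IsCyclic.exists_generator (α := Multiplicative (ZMod n))
    exact ⟨t, (Subgroup.eq_top_iff' _).2 ht⟩
  obtain ⟨hw, hdet⟩ := hgen t ht
  refine ⟨?_, ?_, hgen, ?_, ?_, ?_⟩
  · refine IsLeast.csInf_eq ⟨⟨hone, 1, _, le_rfl, hw, hdet⟩, ?_⟩
    rintro d ⟨hd, r, A, -, hA, rfl⟩
    exact hlow r A hA hd
  · refine IsLeast.csInf_eq ⟨⟨hone, _, hw, hdet⟩, ?_⟩
    rintro d ⟨hd, A, hA, rfl⟩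
    exact hlow 1 A hA hd
  · refine le_csInf ⟨_, hone, 1, 1, _, le_rfl, le_rfl, hdet⟩ ?_
    rintro d ⟨hd, r, s, A, -, -, rfl⟩
    -- For general matrices the integer need not be a square, so only the exponent `1/(2n)` results.
    rw [fkDet_rightMulMatrix, hcard] at hd ⊢
    exact two_rpow_le_of_one_lt (by positivity) hd
  -- The real infimum is monotone only with a lower bound, here `1`, and a nonempty smaller set,
  -- witnessed by `t + 1`.
  · refine csInf_le_csInf ⟨1, fun d hd => hd.1.le⟩ ⟨_, hone, _, hdet⟩ ?_
    rintro d ⟨hd, A, hA⟩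
    exact ⟨hd, 1, 1, A, le_rfl, le_rfl, hA⟩
  · exact csInf_le ⟨1, fun d hd => hd.1.le⟩ ⟨hone, _, hdet⟩
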